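/- Let $G$ be a soluble group with the property that every non-abelian subgroup $K$ of $G$ is self-centralizing, that is, contains its own centralizer: $C_G(K) \le K$. Suppose that $G$ has a subnormal subgroup $H$ that is non-abelian and polycyclic. Then $G$ is polycyclic. (A subgroup $H$ is subnormal in $G$ if there is a finite chain of subgroups $H = H_0 \le H_1 \le \dots \le H_m = G$ with each term normal in the next one; a group $P$ is polycyclic if there is a finite chain of subgroups $1 = P_0 \le P_1 \le \dots \le P_n = P$ with each term normal in the next one and all factors $P_{i+1}/P_i$ cyclic.) -/

import Mathlib

/-- A subgroup `H` of `G` is self-centralizing if its centralizer `C_G(H)` is contained in `H`. -/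
def IsSelfCentralizing {G : Type*} [Group G] (H : Subgroup G) : Prop :=
  Subgroup.centralizer (H : Set G) ≤ H

/-- The class `𝔄`: groups in which every non-abelian subgroup is self-centralizing. -/
def IsAGroup (G : Type*) [Group G] : Prop :=
  ∀ H : Subgroup G, ¬ IsMulCommutative H → IsSelfCentralizing H

/-- A group is polycyclic if it has a finite series
`1 = H 0 ≤ H 1 ≤ ⋯ ≤ H n = G` of subgroups, each normal in the next one and with cyclic
factors `H (i + 1) / H i`. -/
def IsPolycyclicGroup (G : Type*) [Group G] : Prop :=
  ∃ (n : ℕ) (H : ℕ → Subgroup G), H 0 = ⊥ ∧ H n = ⊤ ∧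
    ∀ i < n, H i ≤ H (i + 1) ∧
      ∃ _ : ((H i).subgroupOf (H (i + 1))).Normal,
        IsCyclic (H (i + 1) ⧸ (H i).subgroupOf (H (i + 1)))

/-! A soluble group is polycyclic exactly when all its subgroups are finitely generated, and this
Noetherian condition passes easily to subgroups, quotients and extensions. It is therefore enough to
carry it up the subnormal chain. If `H` is normal in `K`, then conjugation maps `K` to `MulAut H`
with kernel the centralizer of `H` in `K`. As `H` is non-abelian, this kernel lies in `H` and is
Noetherian.

The image is a soluble group of automorphisms of a soluble Noetherian group, so what remains is
Mal'cev's theorem that such groups are Noetherian (`isNoetherianGroup_of_isSolvable_mulAut`). The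
derived series reduces it to a finitely generated abelian group `A`. There a subgroup of finite
index has a common eigenvector `f` in Hom(`A`, ℂ) (`exists_finiteIndex_common_eigenvector`). It acts
on the kernel of `f`, which has smaller rank, and on the image of `f` by multiplication by units of
a number field, a Noetherian group by Dirichlet's unit theorem. -/

/-- A group is Noetherian if all its subgroups are finitely generated. -/
def IsNoetherianGroup (G : Type*) [Group G] : Prop :=
  ∀ K : Subgroup G, K.FG

/-! ### Closure properties of Noetherian groups. -/

namespace IsNoetherianGroup

variable {G P : Type*} [Group G] [Group P]

theorem of_injective (hP : IsNoetherianGroup P) (f : G →* P) (hf : Function.Injective f) :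
    IsNoetherianGroup G := by
  intro K
  have h := hP (K.map f)
  rw [← Group.fg_iff_subgroup_fg] at h ⊢
  exact Group.fg_of_surjective (f := (K.equivMapOfInjective f hf).symm.toMonoidHom)
    (K.equivMapOfInjective f hf).symm.surjective

theorem of_surjective (hG : IsNoetherianGroup G) (f : G →* P) (hf : Function.Surjective f) :
    IsNoetherianGroup P := by
  intro K
  have h := hG (K.comap f)
  obtain ⟨S, hS⟩ := h
  classical
  refine ⟨S.image f, ?_⟩
  rw [Finset.coe_image, ← MonoidHom.map_closure, hS, Subgroup.map_comap_eq_self_of_surjective hf]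

theorem range (hG : IsNoetherianGroup G) (f : G →* P) : IsNoetherianGroup f.range :=
  hG.of_surjective f.rangeRestrict f.rangeRestrict_surjective

theorem subgroup (hG : IsNoetherianGroup G) (K : Subgroup G) : IsNoetherianGroup K :=
  hG.of_injective K.subtype K.subtype_injective

theorem of_le {H K : Subgroup G} (hK : IsNoetherianGroup K) (h : H ≤ K) : IsNoetherianGroup H :=
  hK.of_injective (Subgroup.inclusion h) (Subgroup.inclusion_injective h)

theorem of_ker_of_range (f : G →* P) (hk : IsNoetherianGroup f.ker)
    (hr : IsNoetherianGroup f.range) : IsNoetherianGroup G := by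
  classical
  intro K
  have h1 : (K ⊓ f.ker).FG := by
    rw [← Group.fg_iff_subgroup_fg, Group.fg_def]
    exact (hk.of_le inf_le_right) ⊤
  have h2 : (K.map f).FG := by
    rw [← Group.fg_iff_subgroup_fg, Group.fg_def]
    exact (hr.of_le (Subgroup.map_le_range f K)) ⊤
  obtain ⟨T, hT⟩ := h2
  have hl : ∀ t ∈ T, ∃ s ∈ K, f s = t := fun t ht ↦ by
    have : t ∈ K.map f := hT ▸ Subgroup.subset_closure ht
    simpa using this
  choose! g hgK hg using hl
  have h3 : (Subgroup.closure ((T.image g : Finset G) : Set G)).FG := ⟨_, rfl⟩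
  have hle : Subgroup.closure ((T.image g : Finset G) : Set G) ≤ K := by
    rw [Subgroup.closure_le]
    intro x hx
    simp only [Finset.coe_image, Set.mem_image, Finset.mem_coe] at hx
    obtain ⟨t, ht, rfl⟩ := hx
    exact hgK t ht
  -- Lifts of generators of the image of `K`, together with `K ⊓ f.ker`, generate `K`.
  have : K = Subgroup.closure ((T.image g : Finset G) : Set G) ⊔ (K ⊓ f.ker) := by
    refine le_antisymm ?_ (sup_le hle inf_le_left)
    intro x hx
    have hm : (Subgroup.closure ((T.image g : Finset G) : Set G)).map f = K.map f := by
      rw [MonoidHom.map_closure, ← hT]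
      congr 1
      ext y
      simp only [Finset.coe_image, Set.mem_image, Finset.mem_coe]
      constructor
      · rintro ⟨_, ⟨t, ht, rfl⟩, rfl⟩
        rwa [hg t ht]
      · exact fun hy ↦ ⟨_, ⟨y, hy, rfl⟩, hg y hy⟩
    have hfx : f x ∈ (Subgroup.closure ((T.image g : Finset G) : Set G)).map f := by
      rw [hm]; exact Subgroup.mem_map_of_mem f hx
    obtain ⟨y, hy, hyx⟩ := hfx
    rw [show x = y * (y⁻¹ * x) by group]
    refine Subgroup.mul_mem_sup hy ⟨K.mul_mem (K.inv_mem (hle hy)) hx, ?_⟩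
    simp [hyx]
  rw [this]
  exact h3.sup h1

theorem of_ker (f : G →* P) (hk : IsNoetherianGroup f.ker) (hP : IsNoetherianGroup P) :
    IsNoetherianGroup G :=
  of_ker_of_range f hk (hP.subgroup _)

theorem of_finite [Finite G] : IsNoetherianGroup G := fun K ↦ by
  rw [← Group.fg_iff_subgroup_fg]
  infer_instance

theorem prod (hG : IsNoetherianGroup G) (hP : IsNoetherianGroup P) :
    IsNoetherianGroup (G × P) := by
  refine of_ker (MonoidHom.snd G P) ?_ hP
  refine hG.of_injective ((MonoidHom.fst G P).comp (Subgroup.subtype _)) ?_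
  rintro ⟨⟨a, b⟩, h⟩ ⟨⟨c, d⟩, h'⟩ hac
  rw [MonoidHom.mem_ker] at h h'
  simp_all

theorem pi_fin (hG : IsNoetherianGroup G) (n : ℕ) : IsNoetherianGroup (Fin n → G) := by
  induction n with
  | zero => exact of_finite
  | succ n ih =>
    let f : (Fin (n + 1) → G) →* G × (Fin n → G) :=
      { toFun := fun x ↦ (x 0, fun i ↦ x i.succ)
        map_one' := rfl
        map_mul' := fun _ _ ↦ rfl }
    refine (hG.prod ih).of_injective f ?_
    intro x y hxy
    have h1 := congrArg Prod.fst hxy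
    have h2 := congrArg Prod.snd hxy
    funext i
    refine Fin.cases h1 (fun j ↦ congrFun h2 j) i

theorem pi {ι : Type*} [Finite ι] (hG : IsNoetherianGroup G) : IsNoetherianGroup (ι → G) := by
  obtain ⟨n, ⟨e⟩⟩ := Finite.exists_equiv_fin ι
  let f : (ι → G) →* (Fin n → G) :=
    { toFun := fun x i ↦ x (e.symm i)
      map_one' := rfl
      map_mul' := fun _ _ ↦ rfl }
  refine (hG.pi_fin n).of_injective f fun x y hxy ↦ funext fun i ↦ ?_
  simpa [f] using congrFun hxy (e i)

theorem of_finiteIndex (H : Subgroup G) [H.FiniteIndex] (hH : IsNoetherianGroup H) :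
    IsNoetherianGroup G := by
  refine of_ker (QuotientGroup.mk' H.normalCore) ?_ ?_
  · rw [QuotientGroup.ker_mk']
    exact hH.of_le H.normalCore_le
  · exact of_finite

theorem fg (hG : IsNoetherianGroup G) : Group.FG G :=
  Group.fg_def.mpr (hG ⊤)

theorem wellFoundedGT (hG : IsNoetherianGroup G) : WellFoundedGT (Subgroup G) := by
  rw [wellFoundedGT_iff_monotone_chain_condition]
  intro a
  obtain ⟨S, hS⟩ := hG (⨆ n, a n)
  have hmem : ∀ x ∈ S, ∃ n, x ∈ a n := fun x hx ↦ by
    have : x ∈ ⨆ n, a n := hS ▸ Subgroup.subset_closure hx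
    rwa [Subgroup.mem_iSup_of_directed a.monotone.directed_le] at this
  choose! N hN using hmem
  refine ⟨S.sup N, fun m hm ↦ le_antisymm (a.monotone hm) ?_⟩
  refine (le_iSup a m).trans ?_
  rw [← hS, Subgroup.closure_le]
  exact fun x hx ↦ a.monotone (Finset.le_sup hx) (hN x hx)

theorem of_comm_of_fg {A : Type*} [CommGroup A] [Group.FG A] : IsNoetherianGroup A := by
  have : Module.Finite ℤ (Additive A) := Module.Finite.iff_addGroup_fg.mpr inferInstance
  have hN : IsNoetherian ℤ (Additive A) := inferInstance
  intro K
  rw [Subgroup.fg_iff_add_fg]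
  have := hN.noetherian (AddSubgroup.toIntSubmodule K.toAddSubgroup)
  rw [Submodule.fg_iff_addSubgroup_fg] at this
  simpa using this

end IsNoetherianGroup

/-! ### Polycyclic groups as soluble Noetherian groups. -/

/-- `K` is a normal subgroup of `L` with cyclic quotient. -/
def Subgroup.IsCyclicStep {G : Type*} [Group G] (K L : Subgroup G) : Prop :=
  K ≤ L ∧ ∃ _ : (K.subgroupOf L).Normal, IsCyclic (L ⧸ K.subgroupOf L)

/-- `K` is the last term of a finite series of subgroups starting at `1`, each normal in the next
one and with cyclic factors. -/
def Subgroup.HasCyclicSeries {G : Type*} [Group G] (K : Subgroup G) : Prop :=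
  ∃ (n : ℕ) (H : ℕ → Subgroup G), H 0 = ⊥ ∧ H n = K ∧
    ∀ i < n, (H i).IsCyclicStep (H (i + 1))

namespace Subgroup

variable {G : Type*} [Group G]

theorem hasCyclicSeries_bot : (⊥ : Subgroup G).HasCyclicSeries :=
  ⟨0, fun _ ↦ ⊥, rfl, rfl, by simp⟩

theorem HasCyclicSeries.step {K L : Subgroup G} (hK : K.HasCyclicSeries) (hKL : K.IsCyclicStep L) :
    L.HasCyclicSeries := by
  obtain ⟨n, H, h0, h1, h⟩ := hK
  refine ⟨n + 1, fun i ↦ if i ≤ n then H i else L, by simpa using h0, by simp, ?_⟩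
  intro i hi
  rcases Nat.lt_succ_iff_lt_or_eq.mp hi with hi | rfl
  · have e1 : (if i ≤ n then H i else L) = H i := if_pos hi.le
    have e2 : (if i + 1 ≤ n then H (i + 1) else L) = H (i + 1) := if_pos hi
    change (if i ≤ n then H i else L).IsCyclicStep (if i + 1 ≤ n then H (i + 1) else L)
    rw [e1, e2]
    exact h i hi
  · have e1 : (if i ≤ i then H i else L) = K := by simp [h1]
    have e2 : (if i + 1 ≤ i then H (i + 1) else L) = L := by simp
    change (if i ≤ i then H i else L).IsCyclicStep (if i + 1 ≤ i then H (i + 1) else L)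
    rwa [e1, e2]

theorem HasCyclicSeries.isNoetherianGroup {K : Subgroup G} (hK : K.HasCyclicSeries) :
    IsNoetherianGroup K := by
  obtain ⟨n, H, h0, rfl, h⟩ := hK
  suffices ∀ i ≤ n, IsNoetherianGroup (H i) from this n le_rfl
  intro i
  induction i with
  | zero =>
    intro _
    rw [h0]
    exact IsNoetherianGroup.of_finite
  | succ i ih =>
    intro hi
    obtain ⟨hle, hn, hc⟩ := h i hi
    refine IsNoetherianGroup.of_ker (QuotientGroup.mk' ((H i).subgroupOf (H (i + 1)))) ?_ ?_
    · rw [QuotientGroup.ker_mk']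
      exact (ih (by omega)).of_injective (subgroupOfEquivOfLe hle).toMonoidHom
        (subgroupOfEquivOfLe hle).injective
    · let := hc.commGroup
      have : Group.FG (H (i + 1) ⧸ (H i).subgroupOf (H (i + 1))) := by
        obtain ⟨g, hg⟩ := hc.exists_generator
        refine Group.fg_def.mpr ⟨{g}, ?_⟩
        rw [Finset.coe_singleton, ← zpowers_eq_closure, eq_top_iff']
        exact hg
      exact IsNoetherianGroup.of_comm_of_fg

-- Since `D` is abelian modulo `⁅D, D⁆`, every subgroup between the two is normal in `D`; adjoining
-- `g` adds a factor generated by the class of `g`.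
open scoped commutatorElement in
theorem HasCyclicSeries.sup_zpowers {K D : Subgroup G} (hK : K.HasCyclicSeries) (hKD : K ≤ D)
    (hD : ⁅D, D⁆ ≤ K) {g : G} (hg : g ∈ D) : (K ⊔ zpowers g).HasCyclicSeries := by
  have hle : K ⊔ zpowers g ≤ D := sup_le hKD (zpowers_le.mpr hg)
  have hn : (K.subgroupOf (K ⊔ zpowers g)).Normal := by
    refine ⟨fun x hx y ↦ ?_⟩
    rw [mem_subgroupOf] at hx ⊢
    have : ⁅(y : G), (x : G)⁆ ∈ K := hD (commutator_mem_commutator (hle y.2) (hKD hx))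
    have h2 := K.mul_mem this hx
    simpa [commutatorElement_def] using h2
  refine hK.step ⟨le_sup_left, hn, ⟨QuotientGroup.mk ⟨g, mem_sup_right (mem_zpowers g)⟩, ?_⟩⟩
  intro q
  obtain ⟨⟨x, hx⟩, rfl⟩ := QuotientGroup.mk_surjective q
  have hnorm : zpowers g ≤ normalizer (K : Set G) := by
    rw [zpowers_le, mem_normalizer_iff]
    have key : ∀ u ∈ D, ∀ h ∈ K, u * h * u⁻¹ ∈ K := by
      intro u hu h hh
      have := K.mul_mem (hD (commutator_mem_commutator hu (hKD hh))) hh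
      simpa [commutatorElement_def] using this
    refine fun h ↦ ⟨key g hg h, fun hh ↦ ?_⟩
    have := key g⁻¹ (D.inv_mem hg) _ hh
    simpa [mul_assoc] using this
  have hx' : x ∈ ((zpowers g ⊔ K : Subgroup G) : Set G) := by rwa [sup_comm]
  rw [coe_mul_of_left_le_normalizer_right _ _ hnorm] at hx'
  obtain ⟨_, ⟨k, rfl⟩, z, hz, rfl⟩ := hx'
  refine ⟨k, ?_⟩
  change (QuotientGroup.mk (_ ^ k) : (K ⊔ zpowers g : Subgroup G) ⧸ _) = _
  rw [QuotientGroup.eq, mem_subgroupOf]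
  simpa using hz

/-- Climb the derived series from its trivial term. Between `⁅D, D⁆` and `D`, a maximal subgroup
with a cyclic series exists by the ascending chain condition, and it must be `D`, as any further
element could be adjoined. -/
theorem hasCyclicSeries_top (hG : IsNoetherianGroup G) (hs : Group.IsSolvable G) :
    (⊤ : Subgroup G).HasCyclicSeries := by
  obtain ⟨n, hn⟩ := hs.solvable
  suffices ∀ i ≤ n, (derivedSeries G (n - i)).HasCyclicSeries by
    simpa using this n le_rfl
  intro i
  induction i with
  | zero =>
    intro _
    rw [Nat.sub_zero, hn]
    exact hasCyclicSeries_bot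
  | succ i ih =>
    intro hi
    have hwf := hG.wellFoundedGT
    let D := derivedSeries G (n - (i + 1))
    have hD : derivedSeries G (n - i) = ⁅D, D⁆ := by
      rw [show n - i = n - (i + 1) + 1 by omega, derivedSeries_succ]
    obtain ⟨K, ⟨hK1, hK2, hK3⟩, hmax⟩ := hwf.wf.has_min
      {K : Subgroup G | ⁅D, D⁆ ≤ K ∧ K ≤ D ∧ K.HasCyclicSeries}
      ⟨⁅D, D⁆, le_rfl, commutator_le_self D, hD ▸ ih (by omega)⟩
    suffices h : K = D by
      change D.HasCyclicSeries
      rwa [← h]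
    refine le_antisymm hK2 fun g hg ↦ ?_
    have hle : K ⊔ zpowers g ≤ D := sup_le hK2 (zpowers_le.mpr hg)
    by_contra hgK
    refine hmax (K ⊔ zpowers g) ⟨hK1.trans le_sup_left, hle, hK3.sup_zpowers hK2 hK1 hg⟩ ?_
    refine lt_of_le_of_ne le_sup_left fun h ↦ hgK ?_
    rw [h]
    exact mem_sup_right (mem_zpowers g)

end Subgroup

theorem IsPolycyclicGroup.isNoetherianGroup {G : Type*} [Group G] (hG : IsPolycyclicGroup G) :
    IsNoetherianGroup G :=
  (Subgroup.HasCyclicSeries.isNoetherianGroup (K := (⊤ : Subgroup G)) hG).of_injective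
    (Subgroup.topEquiv (G := G)).symm.toMonoidHom (Subgroup.topEquiv (G := G)).symm.injective

theorem IsNoetherianGroup.isPolycyclicGroup {G : Type*} [Group G] (hG : IsNoetherianGroup G)
    (hs : Group.IsSolvable G) : IsPolycyclicGroup G :=
  Subgroup.hasCyclicSeries_top hG hs

/-! ### Finiteness of weights and common eigenvectors. -/

/-- A subgroup is of finite index if some function with finite range on the group separates its
left cosets. -/
theorem Subgroup.finiteIndex_of_finite_range {G X : Type*} [Group G] (S : Subgroup G) (F : G → X)
    (hF : (Set.range F).Finite) (h : ∀ g g', F g = F g' → g⁻¹ * g' ∈ S) : S.FiniteIndex := by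
  have := hF.to_subtype
  have : Finite (G ⧸ S) := by
    refine Finite.of_injective (β := Set.range F) (fun q ↦ ⟨F q.out, q.out, rfl⟩) ?_
    intro q q' hq
    rw [← q.out_eq', ← q'.out_eq']
    exact QuotientGroup.eq.mpr (h _ _ (congrArg Subtype.val hq))
  exact Subgroup.finiteIndex_of_finite_quotient

section Weights

variable {k V ι : Type*} [Field k] [AddCommGroup V] [Module k V]

theorem linearIndependent_of_common_eigenvectors {S : Type*} (T : ι → Module.End k V)
    (χ : S → ι → k) (hχ : Function.Injective χ) (v : S → V) (hv : ∀ s, v s ≠ 0)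
    (h : ∀ s i, T i (v s) = χ s i • v s) : LinearIndependent k v := by
  classical
  rw [linearIndependent_iff']
  intro s
  induction s using Finset.induction_on with
  | empty => simp
  | insert a s ha ih =>
    intro g hg
    have key : ∀ i ∈ s, g i = 0 := by
      intro i hi
      obtain ⟨j, hj⟩ := Function.ne_iff.mp
        (fun e ↦ ha (hχ e ▸ hi) : χ i ≠ χ a)
      have h1 := congrArg (T j) hg
      have h2 := congrArg (χ a j • ·) hg
      simp only [map_sum, map_smul, h, map_zero, smul_zero, Finset.smul_sum] at h1 h2
      -- Applying `T j - χ a j` to the relation removes the term at `a`.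
      have h3 : ∑ i ∈ s, (g i * (χ i j - χ a j)) • v i = 0 := by
        rw [Finset.sum_insert ha] at h1 h2
        rw [smul_comm] at h2
        have h4 := h1.trans h2.symm
        rw [add_right_inj] at h4
        rw [← sub_eq_zero, ← Finset.sum_sub_distrib] at h4
        rw [← h4]
        refine Finset.sum_congr rfl fun x _ ↦ ?_
        simp only [smul_smul, ← sub_smul]
        congr 1
        ring
      exact (mul_eq_zero.mp (ih _ h3 i hi)).resolve_right (sub_ne_zero.mpr hj)
    intro i hi
    rcases Finset.mem_insert.mp hi with rfl | hi
    · rw [Finset.sum_insert ha, Finset.sum_eq_zero fun i hi ↦ by rw [key i hi, zero_smul],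
        add_zero] at hg
      exact (smul_eq_zero.mp hg).resolve_right (hv i)
    · exact key i hi

/-- This finiteness is the source of the finite-index stabilizers below: a group that permutes
weights has finite orbits on them. -/
theorem finite_setOf_common_eigenvalues [FiniteDimensional k V] (T : ι → Module.End k V) :
    {χ : ι → k | ∃ v ≠ 0, ∀ i, T i v = χ i • v}.Finite := by
  have hl : ∀ χ : {χ : ι → k | ∃ v ≠ 0, ∀ i, T i v = χ i • v},
      ∃ v ≠ 0, ∀ i, T i v = χ.1 i • v := fun χ ↦ χ.2
  choose v hv h using hl
  exact (linearIndependent_of_common_eigenvectors T (fun χ ↦ χ.1) Subtype.val_injective v hv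
    h).finite

/-- In a minimal nonzero invariant subspace, an eigenspace of any one operator is again invariant by
commutativity, hence is everything. -/
theorem exists_common_eigenvector [IsAlgClosed k] [FiniteDimensional k V] [Nontrivial V]
    (T : ι → Module.End k V) (hT : ∀ i j, Commute (T i) (T j)) :
    ∃ χ : ι → k, ∃ v ≠ 0, ∀ i, T i v = χ i • v := by
  obtain ⟨U, ⟨hU0, hU⟩, hmin⟩ := (wellFounded_lt (α := Submodule k V)).has_min
    {U | U ≠ ⊥ ∧ ∀ i, ∀ u ∈ U, T i u ∈ U} ⟨⊤, top_ne_bot, by simp⟩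
  obtain ⟨v, hvU, hv⟩ := U.ne_bot_iff.mp hU0
  have : ∀ i, ∃ c : k, T i v = c • v := by
    intro i
    have : Nontrivial U := Submodule.nontrivial_iff_ne_bot.mpr hU0
    obtain ⟨c, hc⟩ := Module.End.exists_eigenvalue ((T i).restrict (hU i))
    obtain ⟨w, hw⟩ := hc.exists_hasEigenvector
    have hw' : T i w = c • (w : V) := congrArg Subtype.val hw.apply_eq_smul
    refine ⟨c, ?_⟩
    by_contra hne
    refine hmin (U ⊓ (T i).eigenspace c) ⟨?_, ?_⟩ ?_
    · refine (Submodule.ne_bot_iff _).mpr ⟨w, ⟨w.2, Module.End.mem_eigenspace_iff.mpr hw'⟩, ?_⟩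
      simpa using hw.2
    · rintro j u ⟨hu, hu'⟩
      refine ⟨hU j u hu, ?_⟩
      rw [SetLike.mem_coe, Module.End.mem_eigenspace_iff] at hu' ⊢
      have := LinearMap.congr_fun (hT i j) u
      simp only [Module.End.mul_apply] at this
      rw [this, hu', map_smul]
    · refine lt_of_le_of_ne inf_le_left fun h ↦ hne ?_
      have : v ∈ U ⊓ (T i).eigenspace c := by rwa [h]
      exact Module.End.mem_eigenspace_iff.mp this.2
  choose χ hχ using this
  exact ⟨χ, v, hv, hχ⟩

end Weights

/-! ### Mal'cev's theorem on soluble linear groups. -/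

namespace Representation

variable {k G V : Type*} [Field k] [Group G] [AddCommGroup V] [Module k V]

/-- A representation is virtually irreducible if it is irreducible for all subgroups of finite
index. -/
def IsVirtuallyIrreducible (ρ : Representation k G V) : Prop :=
  ∀ (S : Subgroup G) (_ : S.FiniteIndex) (W : Submodule k V),
    (∀ s ∈ S, ∀ w ∈ W, ρ s w ∈ W) → W ≠ ⊥ → W = ⊤

/-- The subgroup of elements acting as scalars. -/
def scalars (ρ : Representation k G V) : Subgroup G where
  carrier := {g | ∃ c : k, ∀ v, ρ g v = c • v}
  one_mem' := ⟨1, by simp⟩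
  mul_mem' := by
    rintro a b ⟨c, hc⟩ ⟨d, hd⟩
    exact ⟨c * d, fun v ↦ by simp [hc, hd, mul_smul, smul_comm c d]⟩
  inv_mem' := by
    rintro a ⟨c, hc⟩
    refine ⟨c⁻¹, fun v ↦ ?_⟩
    by_cases h0 : c = 0
    · have : v = 0 := by
        rw [← ρ.inv_self_apply a v, hc, h0, zero_smul, map_zero]
      simp [this]
    · rw [eq_inv_smul_iff₀ h0, ← hc, ρ.self_inv_apply]

instance (ρ : Representation k G V) : ρ.scalars.Normal where
  conj_mem := by
    rintro a ⟨c, hc⟩ g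
    exact ⟨c, fun v ↦ by simp [hc]⟩

variable [IsAlgClosed k] [FiniteDimensional k V] [Nontrivial V] {ρ : Representation k G V}

/-- Commuting normal subgroups act as scalars. -/
theorem IsVirtuallyIrreducible.le_scalars_of_commute (hρ : ρ.IsVirtuallyIrreducible)
    (A : Subgroup G) [hA : A.Normal] (hc : ∀ a ∈ A, ∀ b ∈ A, Commute (ρ a) (ρ b)) :
    A ≤ ρ.scalars := by
  obtain ⟨χ, v, hv, hχ⟩ := exists_common_eigenvector (fun a : A ↦ ρ a)
    (fun a b ↦ hc a a.2 b b.2)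
  let c : G → A → A := fun g a ↦ ⟨g⁻¹ * a * g, by simpa using hA.conj_mem a a.2 g⁻¹⟩
  have hc1 : ∀ a, c 1 a = a := fun a ↦ by simp [c]
  have hcm : ∀ g h a, c (g * h) a = c h (c g a) := fun g h a ↦ by
    simp only [c, Subtype.mk.injEq]; group
  -- The stabilizer of the weight `χ`; it preserves the weight space `W` below.
  let S : Subgroup G :=
    { carrier := {s | ∀ a, χ (c s a) = χ a}
      one_mem' := fun a ↦ by rw [hc1]
      mul_mem' := fun {x y} hx hy a ↦ by rw [hcm, hy, hx]
      inv_mem' := fun {x} hx a ↦ by rw [← hx (c x⁻¹ a), ← hcm, inv_mul_cancel, hc1] }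
  have hS : S.FiniteIndex := by
    refine S.finiteIndex_of_finite_range (fun g a ↦ χ (c g a))
      ((finite_setOf_common_eigenvalues (fun a : A ↦ ρ a)).subset ?_) ?_
    · rintro _ ⟨g, rfl⟩
      refine ⟨ρ g v, fun h ↦ hv ?_, fun a ↦ ?_⟩
      · rw [← ρ.inv_self_apply g v, h, map_zero]
      · rw [← map_smul, ← hχ]
        simp only [c, ← Module.End.mul_apply, ← map_mul]
        congr 2
        group
    · intro g g' h a
      have := congrFun h (c g⁻¹ a)
      simp only [← hcm] at this
      simpa [hc1] using this.symm
  let W : Submodule k V := ⨅ a : A, Module.End.eigenspace (ρ a) (χ a)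
  have hmem : ∀ w, w ∈ W ↔ ∀ a : A, ρ a w = χ a • w := by
    simp [W, Submodule.mem_iInf]
  have hW := hρ S hS W ?_ ?_
  · intro a ha
    exact ⟨χ ⟨a, ha⟩, fun w ↦ (hmem w).mp (hW ▸ Submodule.mem_top) ⟨a, ha⟩⟩
  · intro s hs w hw
    rw [hmem] at hw ⊢
    intro a
    rw [← hs a, ← map_smul, ← hw]
    simp only [c, ← Module.End.mul_apply, ← map_mul]
    congr 2
    group
  · exact (Submodule.ne_bot_iff _).mpr ⟨v, (hmem v).mpr hχ, hv⟩

open scoped commutatorElement in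
/-- Normal subgroups that are abelian modulo scalars act as scalars. -/
theorem IsVirtuallyIrreducible.le_scalars_of_commutator_le (hρ : ρ.IsVirtuallyIrreducible)
    (E : Subgroup G) [hE : E.Normal] (hc : ⁅E, E⁆ ≤ ρ.scalars) : E ≤ ρ.scalars := by
  -- The elements of `E` that are central in the image of `E`; they are scalars by the commuting
  -- case.
  let A : Subgroup G :=
    { carrier := {x | x ∈ E ∧ ∀ y ∈ E, Commute (ρ x) (ρ y)}
      one_mem' := ⟨E.one_mem, fun y _ ↦ by simp⟩
      mul_mem' := fun {x x'} hx hx' ↦ ⟨E.mul_mem hx.1 hx'.1, fun y hy ↦ by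
        rw [map_mul]; exact (hx.2 y hy).mul_left (hx'.2 y hy)⟩
      inv_mem' := fun {x} hx ↦ ⟨E.inv_mem hx.1, fun y hy ↦ by
        have h := hx.2 y hy
        have h1 : ρ x⁻¹ * ρ x = 1 := by rw [← map_mul]; simp
        have h2 : ρ x * ρ x⁻¹ = 1 := by rw [← map_mul]; simp
        calc ρ x⁻¹ * ρ y = ρ x⁻¹ * (ρ y * ρ x) * ρ x⁻¹ := by
              rw [mul_assoc, mul_assoc, h2, mul_one]
          _ = ρ x⁻¹ * ρ x * ρ y * ρ x⁻¹ := by rw [← h.eq]; simp only [mul_assoc]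
          _ = ρ y * ρ x⁻¹ := by rw [h1, one_mul]⟩ }
  have hAn : A.Normal := by
    refine ⟨fun x hx g ↦ ⟨hE.conj_mem x hx.1 g, fun y hy ↦ ?_⟩⟩
    have h := hx.2 (g⁻¹ * y * g) (by simpa using hE.conj_mem y hy g⁻¹)
    have h' := congrArg (fun t ↦ ρ g * t * ρ g⁻¹) h.eq
    simp only [← map_mul] at h'
    change ρ _ * ρ _ = ρ _ * ρ _
    rw [← map_mul, ← map_mul]
    convert h' using 2 <;> group
  have hAs : A ≤ ρ.scalars :=
    hρ.le_scalars_of_commute A fun a ha b hb ↦ ha.2 b hb.1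
  intro e he
  -- Since `f * x * f⁻¹ = ⁅f, x⁆ * x`, the operator `ρ x` is a weight vector in `End V` for
  -- conjugation by `E`.
  have hw : ∀ x : E, ∃ χ : E → k, ∀ f : E, ∀ v, ρ (f * x * (f : G)⁻¹) v = χ f • ρ x v := by
    intro x
    have : ∀ f : E, ∃ c : k, ∀ v, ρ (f * x * (f : G)⁻¹) v = c • ρ x v := fun f ↦ by
      obtain ⟨c, h⟩ := hc (Subgroup.commutator_mem_commutator f.2 x.2)
      refine ⟨c, fun v ↦ ?_⟩
      rw [← h, ← Module.End.mul_apply, ← map_mul, commutatorElement_def]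
      congr 2
      group
    choose χ hχ using this
    exact ⟨χ, hχ⟩
  choose χ hχ using hw
  let T : E → Module.End k (Module.End k V) := fun f ↦
    LinearMap.mulLeft k (ρ f) ∘ₗ LinearMap.mulRight k (ρ (f : G)⁻¹)
  let c : G → E := fun g ↦ ⟨g * e * g⁻¹, hE.conj_mem e he g⟩
  have hne : ∀ x : G, ρ x ≠ 0 := fun x hx ↦ by
    obtain ⟨v, hv⟩ := exists_ne (0 : V)
    apply hv
    rw [← ρ.inv_self_apply x v, hx]
    simp
  let π := QuotientGroup.mk' ρ.scalars
  -- The centralizer of `e` modulo scalars. Conjugates of `e` with equal weights differ by an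
  -- element of `A`, and there are finitely many weights.
  let S : Subgroup G := (Subgroup.centralizer {π e}).comap π
  have hmemS : ∀ g, g ∈ S ↔ π g * π e = π e * π g := fun g ↦ by
    simp [S, Subgroup.mem_comap, Subgroup.mem_centralizer_singleton_iff, eq_comm]
  have hS : S.FiniteIndex := by
    refine S.finiteIndex_of_finite_range (fun g ↦ χ (c g))
      ((finite_setOf_common_eigenvalues T).subset ?_) ?_
    · rintro _ ⟨g, rfl⟩
      refine ⟨ρ (c g), hne _, fun f ↦ ?_⟩
      ext v
      have := hχ (c g) f v
      simpa [T] using this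
    · intro g g' h
      have hmem : (c g : G)⁻¹ * c g' ∈ A := by
        refine ⟨E.mul_mem (E.inv_mem (c g).2) (c g').2, fun f hf ↦ ?_⟩
        have h1 : ∀ v, ρ (f * ((c g : G)⁻¹ * c g') * f⁻¹) v = ρ ((c g : G)⁻¹ * c g') v := by
          intro v
          have h3 : ρ (f * c g * f⁻¹) (ρ (f * ((c g : G)⁻¹ * c g') * f⁻¹) v) =
              ρ (f * c g * f⁻¹) (ρ ((c g : G)⁻¹ * c g') v) := by
            rw [hχ (c g) ⟨f, hf⟩ (ρ ((c g : G)⁻¹ * c g') v), ← Module.End.mul_apply (ρ (c g)),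
              ← map_mul, mul_inv_cancel_left, congrFun h ⟨f, hf⟩, ← hχ (c g') ⟨f, hf⟩,
              ← Module.End.mul_apply, ← map_mul]
            congr 2
            group
          rw [← ρ.inv_self_apply (f * c g * f⁻¹) (ρ (f * _ * f⁻¹) v), h3, ρ.inv_self_apply]
        refine LinearMap.ext fun v ↦ ?_
        have := h1 (ρ f v)
        rw [Module.End.mul_apply, ← this, ← Module.End.mul_apply, ← map_mul, ← map_mul]
        congr 2
        group
      have h2 : π (c g) = π (c g') := QuotientGroup.eq.mpr (hAs hmem)
      simp only [c, map_mul, map_inv] at h2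
      rw [hmemS]
      simp only [map_mul, map_inv]
      calc (π g)⁻¹ * π g' * π e = (π g)⁻¹ * (π g' * π e * (π g')⁻¹) * π g' := by group
        _ = π e * ((π g)⁻¹ * π g') := by rw [← h2]; group
  have hS' : ∀ g : S, ∃ a : k, ∀ v, ρ (g * e * (g : G)⁻¹) v = a • ρ e v := by
    rintro ⟨g, hg⟩
    rw [hmemS] at hg
    have : e⁻¹ * (g * e * g⁻¹) ∈ ρ.scalars := by
      refine (QuotientGroup.eq (s := ρ.scalars)).mp ?_
      change π e = π (g * e * g⁻¹)
      rw [map_mul, map_mul, map_inv, hg]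
      group
    obtain ⟨a, ha⟩ := this
    refine ⟨a, fun v ↦ ?_⟩
    rw [← map_smul, ← ha, ← Module.End.mul_apply, ← map_mul]
    congr 2
    group
  choose a ha using hS'
  let C : Subgroup G :=
    { carrier := {g | ∀ v, ρ g (ρ e v) = ρ e (ρ g v)}
      one_mem' := by simp
      mul_mem' := fun {x y} hx hy v ↦ by
        rw [map_mul, Module.End.mul_apply, Module.End.mul_apply, hy, hx]
      inv_mem' := fun {x} hx v ↦ by
        rw [← ρ.inv_self_apply x (ρ e (ρ x⁻¹ v)), hx, ρ.self_inv_apply] }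
  obtain ⟨μ, hμ⟩ := Module.End.exists_eigenvalue (ρ e)
  obtain ⟨v, hv⟩ := hμ.exists_hasEigenvector
  have hμ0 : μ ≠ 0 := by
    rintro rfl
    apply hv.2
    rw [← ρ.inv_self_apply e v, hv.apply_eq_smul, zero_smul, map_zero]
  -- If `g * e * g⁻¹` acts as `a g • ρ e`, then `ρ g` sends `v` to an eigenvector of `ρ e` for `(a
  -- g)⁻¹ * μ`, so `a` takes finitely many values.
  have hC : (C.subgroupOf S).FiniteIndex := by
    refine Subgroup.finiteIndex_of_finite_range _ (fun g ↦ (a g)⁻¹ * μ)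
      ((Module.End.finite_hasEigenvalue (ρ e)).subset ?_) ?_
    · rintro _ ⟨g, rfl⟩
      have h0 : a g ≠ 0 := by
        intro h0
        refine hne (g * e * (g : G)⁻¹) (LinearMap.ext fun v ↦ ?_)
        rw [ha, h0, zero_smul, LinearMap.zero_apply]
      refine Module.End.hasEigenvalue_of_hasEigenvector (x := ρ g v)
        ⟨Module.End.mem_eigenspace_iff.mpr ?_, fun h ↦ hv.2 ?_⟩
      · rw [mul_smul, eq_inv_smul_iff₀ h0, ← ha, ← map_smul, ← hv.apply_eq_smul]
        simp only [← Module.End.mul_apply, ← map_mul]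
        congr 2
        group
      · rw [← ρ.inv_self_apply g v, h, map_zero]
    · intro g g' h
      have h' : a g = a g' := inv_injective (mul_right_cancel₀ hμ0 h)
      rw [Subgroup.mem_subgroupOf]
      intro w
      have h1 := ha g (ρ g' w)
      rw [h', ← ha g'] at h1
      have h2 := congrArg (ρ (g : G)⁻¹) h1
      simp only [← Module.End.mul_apply, ← map_mul] at h2 ⊢
      simp only [mul_assoc, inv_mul_cancel_left, inv_mul_cancel, mul_one] at h2 ⊢
      push_cast
      simp only [mul_assoc]
      exact h2.symm
  have hCS : (C ⊓ S).FiniteIndex := by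
    refine ⟨?_⟩
    rw [← Subgroup.relIndex_mul_index (inf_le_right : C ⊓ S ≤ S), Subgroup.inf_relIndex_right]
    exact mul_ne_zero hC.index_ne_zero hS.index_ne_zero
  have htop := hρ (C ⊓ S) hCS (Module.End.eigenspace (ρ e) μ) ?_ ?_
  · exact ⟨μ, fun w ↦ Module.End.mem_eigenspace_iff.mp (htop ▸ Submodule.mem_top)⟩
  · intro s hs w hw
    rw [Module.End.mem_eigenspace_iff] at hw ⊢
    rw [← hs.1 w, hw, map_smul]
  · exact (Submodule.ne_bot_iff _).mpr ⟨v, hv.1, hv.2⟩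

theorem IsVirtuallyIrreducible.scalars_eq_top (hρ : ρ.IsVirtuallyIrreducible)
    (hG : Group.IsSolvable G) : ρ.scalars = ⊤ := by
  obtain ⟨n, hn⟩ := hG.solvable
  suffices ∀ i ≤ n, derivedSeries G (n - i) ≤ ρ.scalars by
    simpa using this n le_rfl
  intro i
  induction i with
  | zero => intro _; simp [hn]
  | succ i ih =>
    intro hi
    have := derivedSeries_normal G (n - (i + 1))
    refine hρ.le_scalars_of_commutator_le _ ?_
    rw [← derivedSeries_succ, show n - (i + 1) + 1 = n - i by omega]
    exact ih (by omega)

/-- **Mal'cev**: a soluble group of linear maps over an algebraically closed field has a subgroup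
of finite index with a common eigenvector. -/
theorem exists_finiteIndex_common_eigenvector (hG : Group.IsSolvable G) (ρ : Representation k G V) :
    ∃ S : Subgroup G, S.FiniteIndex ∧ ∃ v ≠ 0, ∀ s ∈ S, ∃ c : k, ρ s v = c • v := by
  -- Minimality over all finite-index subgroups at once makes `W` virtually irreducible for `S`.
  obtain ⟨W, ⟨hW0, S, hS, hW⟩, hmin⟩ := (wellFounded_lt (α := Submodule k V)).has_min
    {W | W ≠ ⊥ ∧ ∃ S : Subgroup G, S.FiniteIndex ∧ ∀ s ∈ S, ∀ w ∈ W, ρ s w ∈ W}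
    ⟨⊤, top_ne_bot, ⊤, inferInstance, by simp⟩
  have : Nontrivial W := Submodule.nontrivial_iff_ne_bot.mpr hW0
  let σ : Representation k S W :=
    { toFun := fun s ↦ (ρ s).restrict (hW s s.2)
      map_one' := by ext; simp
      map_mul' := fun x y ↦ by ext; simp }
  have hσv : ∀ s w, (σ s w : V) = ρ s w := fun _ _ ↦ rfl
  have hσ : σ.IsVirtuallyIrreducible := by
    intro S' hS' U hU hU0
    by_contra hne
    refine hmin (U.map W.subtype) ⟨?_, S'.map S.subtype, ?_, ?_⟩ ?_
    · rw [← Submodule.map_bot W.subtype]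
      exact (Submodule.map_injective_of_injective W.subtype_injective).ne hU0
    · refine ⟨?_⟩
      rw [Subgroup.index_map_subtype]
      exact mul_ne_zero hS'.index_ne_zero hS.index_ne_zero
    · rintro _ ⟨s, hs, rfl⟩ _ ⟨w, hw, rfl⟩
      exact ⟨σ s w, hU s hs w hw, rfl⟩
    · refine lt_of_le_of_ne (Submodule.map_subtype_le W U) fun h ↦ hne ?_
      apply Submodule.map_injective_of_injective W.subtype_injective
      rw [h, Submodule.map_top, Submodule.range_subtype]
  have htop := hσ.scalars_eq_top inferInstance
  obtain ⟨v, hv⟩ := exists_ne (0 : W)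
  refine ⟨S, hS, v, by simpa using hv, fun s hs ↦ ?_⟩
  have : (⟨s, hs⟩ : S) ∈ σ.scalars := htop ▸ Subgroup.mem_top _
  obtain ⟨c, hc⟩ := this
  exact ⟨c, congrArg Subtype.val (hc v)⟩

end Representation

/-! ### Units preserving a lattice. -/

open NumberField in
/-- A group of units preserving a nonzero finitely generated additive subgroup of `ℂ` is
Noetherian, by Dirichlet's unit theorem. -/
theorem isNoetherianGroup_of_preserves_lattice (L : Submodule ℤ ℂ) (hL : L.FG) (hL0 : L ≠ ⊥)
    (U : Subgroup ℂˣ) (hU : ∀ u ∈ U, ∀ l ∈ L, (u : ℂ) * l ∈ L) : IsNoetherianGroup U := by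
  -- The multiplier ring of `L`. It embeds in `L` by `r ↦ r * x`, so it is finite over ℤ and
  -- consists of algebraic integers.
  let R : Subalgebra ℤ ℂ :=
    { carrier := {r | ∀ l ∈ L, r * l ∈ L}
      mul_mem' := fun {a b} ha hb l hl ↦ by rw [mul_assoc]; exact ha _ (hb l hl)
      add_mem' := fun {a b} ha hb l hl ↦ by rw [add_mul]; exact L.add_mem (ha l hl) (hb l hl)
      algebraMap_mem' := fun n l hl ↦ by
        rw [← Algebra.smul_def]; exact L.smul_mem n hl }
  obtain ⟨x, hxL, hx⟩ := L.ne_bot_iff.mp hL0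
  have : Module.Finite ℤ L := Module.Finite.iff_fg.mpr hL
  let f : R →ₗ[ℤ] L :=
    { toFun := fun r ↦ ⟨r * x, r.2 x hxL⟩
      map_add' := fun r s ↦ by ext; simp [add_mul]
      map_smul' := fun n r ↦ by ext; simp [mul_assoc] }
  have hf : Function.Injective f := fun r s h ↦
    Subtype.ext (mul_right_cancel₀ hx (congrArg Subtype.val h))
  have hR : Module.Finite ℤ R := Module.Finite.of_injective f hf
  have hint : ∀ r ∈ R, IsIntegral ℤ r := fun r hr ↦
    (Algebra.IsIntegral.isIntegral (R := ℤ) (⟨r, hr⟩ : R)).map R.val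
  obtain ⟨t, ht⟩ : (Subalgebra.toSubmodule R).FG := Module.Finite.iff_fg.mp hR
  have htR : ∀ r ∈ (t : Set ℂ), r ∈ R := fun r hr ↦ by
    rw [← Subalgebra.mem_toSubmodule, ← ht]
    exact Submodule.subset_span hr
  let K := IntermediateField.adjoin ℚ (t : Set ℂ)
  have hK : FiniteDimensional ℚ K :=
    IntermediateField.finiteDimensional_adjoin fun r hr ↦ (hint r (htR r hr)).tower_top
  have : NumberField K := { to_charZero := inferInstance, to_finiteDimensional := hK }
  have hRK : ∀ r ∈ R, r ∈ K := fun r hr ↦ by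
    rw [← Subalgebra.mem_toSubmodule, ← ht] at hr
    refine Submodule.span_induction (fun x hx ↦ IntermediateField.subset_adjoin ℚ _ hx)
      K.zero_mem (fun x y _ _ hx hy ↦ K.add_mem hx hy) (fun n x _ hx ↦ K.zsmul_mem hx n) hr
  have hRO : ∀ r (hr : r ∈ R), (⟨r, hRK r hr⟩ : K) ∈ integralClosure ℤ K := fun r hr ↦
    (isIntegral_algebraMap_iff (A := K) (B := ℂ) (algebraMap K ℂ).injective).mp (hint r hr)
  have hO : IsNoetherianGroup (𝓞 K)ˣ := by
    have : Group.FG (𝓞 K)ˣ := Group.fg_iff_monoid_fg.mpr inferInstance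
    exact IsNoetherianGroup.of_comm_of_fg
  let ψ : (𝓞 K)ˣ →* ℂˣ :=
    Units.map (((algebraMap K ℂ).comp (algebraMap (𝓞 K) K)) : 𝓞 K →* ℂ)
  refine (hO.range ψ).of_le fun u hu ↦ ?_
  have h1 : (u : ℂ) ∈ R := hU u hu
  have h2 : ((u⁻¹ : ℂˣ) : ℂ) ∈ R := hU _ (U.inv_mem hu)
  refine ⟨⟨⟨⟨u, hRK _ h1⟩, hRO _ h1⟩, ⟨⟨(u⁻¹ : ℂˣ), hRK _ h2⟩, hRO _ h2⟩, ?_, ?_⟩, ?_⟩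
  · exact Subtype.ext (Subtype.ext u.mul_inv)
  · exact Subtype.ext (Subtype.ext u.inv_mul)
  · ext; rfl

/-! ### Soluble groups of automorphisms. -/

/-- The restriction of a group of automorphisms to an invariant subgroup. -/
def MulAut.restrictInvariant {H : Type*} [Group H] (S : Subgroup (MulAut H)) (N : Subgroup H)
    (hN : ∀ s ∈ S, ∀ n ∈ N, s n ∈ N) : S →* MulAut N where
  toFun s :=
    { toFun := fun n ↦ ⟨s.1 n, hN s s.2 n n.2⟩
      invFun := fun n ↦ ⟨(s⁻¹).1 n, hN _ (s⁻¹).2 n n.2⟩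
      left_inv := fun n ↦ Subtype.ext (MulAut.inv_apply_self H s.1 n)
      right_inv := fun n ↦ Subtype.ext (MulAut.apply_inv_self H s.1 n)
      map_mul' := fun m n ↦ Subtype.ext (map_mul s.1 (m : H) n) }
  map_one' := rfl
  map_mul' _ _ := rfl

theorem MulAut.eq_of_restrictInvariant_eq_one {H : Type*} [Group H] {S : Subgroup (MulAut H)}
    {N : Subgroup H} {hN : ∀ s ∈ S, ∀ n ∈ N, s n ∈ N} {s : S}
    (hs : MulAut.restrictInvariant S N hN s = 1) {n : H} (hn : n ∈ N) : s.1 n = n :=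
  congrArg (Subtype.val : N → H) (DFunLike.congr_fun hs (⟨n, hn⟩ : N))

/-- A group of automorphisms of `H` is Noetherian if it acts as a Noetherian group on a Noetherian
subgroup `N` of `H` and modulo `N`. -/
theorem isNoetherianGroup_of_action {H Q₁ Q₂ : Type*} [Group H] [Group Q₁] [Group Q₂]
    [hfg : Group.FG H] (S : Subgroup (MulAut H)) (N : Subgroup H) (hN : IsNoetherianGroup N)
    (φ₁ : S →* Q₁) (h₁ : IsNoetherianGroup φ₁.range)
    (hk₁ : ∀ s, φ₁ s = 1 → ∀ n ∈ N, s.1 n = n)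
    (φ₂ : S →* Q₂) (h₂ : IsNoetherianGroup φ₂.range)
    (hk₂ : ∀ s, φ₂ s = 1 → ∀ h, h⁻¹ * s.1 h ∈ N) : IsNoetherianGroup S := by
  refine IsNoetherianGroup.of_ker (φ₁.rangeRestrict.prod φ₂.rangeRestrict) ?_ (h₁.prod h₂)
  have hk : ∀ s ∈ (φ₁.rangeRestrict.prod φ₂.rangeRestrict).ker, φ₁ s = 1 ∧ φ₂ s = 1 := by
    intro s hs
    rw [MonoidHom.mem_ker] at hs
    exact ⟨congrArg (fun x ↦ x.1.1) hs, congrArg (fun x ↦ x.2.1) hs⟩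
  obtain ⟨T, hT⟩ := hfg.out
  -- The derivation `t ↦ t⁻¹ * s t` on generators of `H`; it is multiplicative in `s` because the
  -- kernel fixes `N` pointwise.
  let f : (φ₁.rangeRestrict.prod φ₂.rangeRestrict).ker →* (T → N) :=
    { toFun := fun s t ↦ ⟨(t : H)⁻¹ * s.1.1 t, hk₂ _ (hk _ s.2).2 t⟩
      map_one' := by ext; simp
      map_mul' := fun s s' ↦ by
        ext t
        have h := hk₁ _ (hk _ s.2).1 _ (hk₂ _ (hk _ s'.2).2 t)
        rw [map_mul, map_inv, inv_mul_eq_iff_eq_mul] at h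
        change (t : H)⁻¹ * s.1.1 (s'.1.1 t) = (t : H)⁻¹ * s.1.1 t * ((t : H)⁻¹ * s'.1.1 t)
        rw [h, mul_assoc] }
  refine hN.pi.of_injective f fun s s' h ↦ ?_
  have h1 : ∀ t ∈ T, s.1.1 t = s'.1.1 t := fun t ht ↦
    mul_left_cancel (congrArg Subtype.val (congrFun h ⟨t, ht⟩))
  have h2 : (s.1.1 : H →* H) = s'.1.1 := MonoidHom.eq_of_eqOn_dense hT h1
  exact Subtype.ext (Subtype.ext (MulEquiv.ext fun x ↦ DFunLike.congr_fun h2 x))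

/-- An infinite finitely generated abelian group is not torsion, and its torsion-free quotient is
free, so integral functionals separate points there. -/
theorem exists_linearMap_complex_ne_zero {M : Type*} [AddCommGroup M] [Module.Finite ℤ M]
    [Infinite M] : ∃ f : M →ₗ[ℤ] ℂ, f ≠ 0 := by
  have hnt : ¬ Module.IsTorsion ℤ M := fun h ↦ by
    have := Module.finite_of_fg_torsion M h
    exact not_finite M
  obtain ⟨x, hx⟩ : ∃ x, x ∉ Submodule.torsion ℤ M := by
    by_contra! h
    exact hnt fun x ↦ h x
  have hq : (Submodule.mkQ (Submodule.torsion ℤ M)) x ≠ 0 := by simpa using hx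
  have : Module.Free ℤ (M ⧸ Submodule.torsion ℤ M) := Module.free_of_finite_type_torsion_free'
  obtain ⟨g, hg⟩ : ∃ g : Module.Dual ℤ (M ⧸ Submodule.torsion ℤ M), g (Submodule.mkQ _ x) ≠ 0 := by
    by_contra! h
    exact hq ((Module.forall_dual_apply_eq_zero_iff ℤ _).mp h)
  refine ⟨(Algebra.linearMap ℤ ℂ) ∘ₗ g ∘ₗ Submodule.mkQ _, fun h ↦ hg ?_⟩
  simpa using LinearMap.congr_fun h x

instance {M : Type*} [AddCommGroup M] [Module.Finite ℤ M] :
    FiniteDimensional ℂ (M →ₗ[ℤ] ℂ) := by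
  obtain ⟨T, hT⟩ := Module.Finite.fg_top (R := ℤ) (M := M)
  let f : (M →ₗ[ℤ] ℂ) →ₗ[ℂ] (T → ℂ) :=
    { toFun := fun g t ↦ g t
      map_add' := fun _ _ ↦ rfl
      map_smul' := fun _ _ ↦ rfl }
  exact FiniteDimensional.of_injective f fun g g' h ↦
    LinearMap.ext_on hT fun t ht ↦ congrFun h ⟨t, ht⟩

/-- Soluble groups of automorphisms of finitely generated abelian groups are Noetherian. -/
theorem isNoetherianGroup_of_isSolvable_mulAut_comm {A : Type*} [CommGroup A] [Group.FG A]
    (S : Subgroup (MulAut A)) (hS : Group.IsSolvable S) : IsNoetherianGroup S := by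
  induction hd : Module.finrank ℤ (Additive A) using Nat.strong_induction_on generalizing A with
  | h d ih =>
  have hAf : Module.Finite ℤ (Additive A) := Module.Finite.iff_addGroup_fg.mpr inferInstance
  rcases finite_or_infinite A with hA | hA
  · have : Finite (MulAut A) := DFunLike.finite _
    exact IsNoetherianGroup.of_finite
  have : Infinite (Additive A) := hA
  obtain ⟨f₀, hf₀⟩ := exists_linearMap_complex_ne_zero (M := Additive A)
  have : Nontrivial (Additive A →ₗ[ℤ] ℂ) := ⟨f₀, 0, hf₀⟩
  -- The contragredient action; the inverse makes it a left action.
  let ρ : Representation ℂ S (Additive A →ₗ[ℤ] ℂ) :=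
    { toFun := fun s ↦
        { toFun := fun f ↦ f ∘ₗ (MonoidHom.toAdditive (s⁻¹).1.toMonoidHom).toIntLinearMap
          map_add' := fun _ _ ↦ rfl
          map_smul' := fun _ _ ↦ rfl }
      map_one' := rfl
      map_mul' := fun s s' ↦ by
        ext f a
        simp only [mul_inv_rev]
        rfl }
  have hρ : ∀ s f a, ρ s f (Additive.ofMul a) = f (Additive.ofMul ((s⁻¹).1 a)) :=
    fun _ _ _ ↦ rfl
  obtain ⟨S₀, hS₀, f, hf, hχ⟩ := Representation.exists_finiteIndex_common_eigenvector hS ρ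
  refine IsNoetherianGroup.of_finiteIndex S₀ ?_
  let R : Subgroup (MulAut A) := S₀.map S.subtype
  have hRS : R ≤ S := Subgroup.map_subtype_le S₀
  suffices IsNoetherianGroup R from this.of_injective
    (S₀.equivMapOfInjective S.subtype S.subtype_injective).toMonoidHom
    (S₀.equivMapOfInjective S.subtype S.subtype_injective).injective
  have hRsol : Group.IsSolvable R :=
    Group.isSolvable_of_isSolvable_injective (Subgroup.inclusion_injective hRS)
  have hχ' : ∀ s : R, ∃ c : ℂ, ∀ a, f (Additive.ofMul (s.1 a)) = c * f (Additive.ofMul a) := by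
    rintro ⟨_, s, hs, rfl⟩
    obtain ⟨c, hc⟩ := hχ s⁻¹ (S₀.inv_mem hs)
    refine ⟨c, fun a ↦ ?_⟩
    have := LinearMap.congr_fun hc (Additive.ofMul a)
    rwa [hρ, inv_inv] at this
  choose χ hχ using hχ'
  obtain ⟨a₀, ha₀⟩ : ∃ a : A, f (Additive.ofMul a) ≠ 0 := by
    by_contra! h
    exact hf (LinearMap.ext h)
  let χm : R →* ℂ :=
    { toFun := χ
      map_one' := by
        have := hχ 1 a₀
        exact (mul_right_cancel₀ ha₀ ((one_mul _).trans this)).symm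
      map_mul' := fun s t ↦ by
        refine mul_right_cancel₀ ha₀ ?_
        rw [← hχ, mul_assoc, ← hχ t, ← hχ s]
        rfl }
  let N : Subgroup A :=
    { carrier := {a | f (Additive.ofMul a) = 0}
      one_mem' := map_zero f
      mul_mem' := fun {a b} ha hb ↦ by
        have : f (Additive.ofMul a + Additive.ofMul b) = 0 := by
          rw [map_add, ha.out, hb.out, add_zero]
        exact this
      inv_mem' := fun {a} ha ↦ by
        have : f (-Additive.ofMul a) = 0 := by rw [map_neg, ha.out, neg_zero]
        exact this }
  have hmemN : ∀ a, a ∈ N ↔ f (Additive.ofMul a) = 0 := fun _ ↦ Iff.rfl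
  have hNinv : ∀ s ∈ R, ∀ n ∈ N, s n ∈ N := fun s hs n hn ↦ by
    rw [hmemN] at hn ⊢
    rw [hχ ⟨s, hs⟩, hn, mul_zero]
  have hAN : IsNoetherianGroup A := IsNoetherianGroup.of_comm_of_fg
  have hNN : IsNoetherianGroup N := hAN.subgroup N
  have hNfg := hNN.fg
  have hrange : Nontrivial (LinearMap.range f) :=
    Submodule.nontrivial_iff_ne_bot.mpr fun h ↦ hf (LinearMap.range_eq_bot.mp h)
  -- The image of `f` is a nonzero finitely generated subgroup of ℂ, so it has positive rank.
  have hrank : Module.finrank ℤ (Additive N) < d := by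
    let e : Additive N ≃+ LinearMap.ker f :=
      { toFun := fun a ↦ ⟨Additive.ofMul (a.toMul : A), a.toMul.2⟩
        invFun := fun a ↦ Additive.ofMul ⟨a.1.toMul, a.2⟩
        left_inv := fun _ ↦ rfl
        right_inv := fun _ ↦ rfl
        map_add' := fun _ _ ↦ rfl }
    have h1 := (LinearMap.ker f).finrank_quotient_add_finrank
    have h4 := f.quotKerEquivRange.finrank_eq
    have h2 : 0 < Module.finrank ℤ (LinearMap.range f) := Module.finrank_pos
    have h3 := e.toIntLinearEquiv.finrank_eq
    omega
  refine isNoetherianGroup_of_action R N hNN (MulAut.restrictInvariant R N hNinv)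
    (ih _ hrank _ ?_ rfl) (fun s hs n hn ↦ MulAut.eq_of_restrictInvariant_eq_one hs hn)
    χm.toHomUnits ?_ ?_
  · exact Group.isSolvable_of_surjective (MonoidHom.rangeRestrict_surjective _)
  · refine isNoetherianGroup_of_preserves_lattice (LinearMap.range f)
      (Module.Finite.iff_fg.mp inferInstance) (Submodule.nontrivial_iff_ne_bot.mp hrange) _ ?_
    rintro _ ⟨s, rfl⟩ _ ⟨a, rfl⟩
    exact ⟨Additive.ofMul (s.1 a.toMul), hχ s _⟩
  · intro s hs a
    have h1 : χ s = 1 := congrArg Units.val hs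
    have h2 := hχ s a
    rw [h1, one_mul] at h2
    have : f (-Additive.ofMul a + Additive.ofMul (s.1 a)) = 0 := by
      rw [map_add, map_neg, h2, neg_add_cancel]
    exact this

/-- Soluble groups of automorphisms of soluble Noetherian groups are Noetherian. -/
theorem isNoetherianGroup_of_isSolvable_mulAut {H : Type*} [Group H] (hH : IsNoetherianGroup H)
    (hsol : Group.IsSolvable H) (S : Subgroup (MulAut H)) (hS : Group.IsSolvable S) :
    IsNoetherianGroup S := by
  obtain ⟨n, hn⟩ := hsol.solvable
  induction n generalizing H with
  | zero =>
    have : Subsingleton H := by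
      rw [derivedSeries_zero] at hn
      exact Subgroup.subsingleton_iff.mp (subsingleton_of_bot_eq_top hn.symm)
    have : Subsingleton (MulAut H) := ⟨fun f g ↦ MulEquiv.ext fun x ↦ Subsingleton.elim _ _⟩
    exact IsNoetherianGroup.of_finite
  | succ n ih =>
    let N := commutator H
    have hNinv : ∀ s ∈ S, ∀ x ∈ N, s x ∈ N := fun s _ x hx ↦
      (Subgroup.characteristic_iff_le_comap.mp (inferInstance : N.Characteristic) s) hx
    -- The derived series of `N` is that of `H` shifted by one, so the induction applies.
    have hNn : derivedSeries N n = ⊥ := by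
      have hmap : ∀ k, (derivedSeries N k).map N.subtype = derivedSeries H (k + 1) := fun k ↦ by
        induction k with
        | zero => rw [derivedSeries_zero, ← MonoidHom.range_eq_map, N.range_subtype,
            derivedSeries_one]
        | succ k ih => rw [derivedSeries_succ, Subgroup.map_commutator, ih, ← derivedSeries_succ]
      rw [← Subgroup.map_eq_bot_iff_of_injective _ N.subtype_injective, hmap, hn]
    have hfg := hH.fg
    let φ₂ : S →* MulAut (Abelianization H) :=
      { toFun := fun s ↦ MulEquiv.abelianizationCongr s.1
        map_one' := by
          ext x
          obtain ⟨x, rfl⟩ := QuotientGroup.mk_surjective x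
          rfl
        map_mul' := fun s t ↦ by
          ext x
          obtain ⟨x, rfl⟩ := QuotientGroup.mk_surjective x
          rfl }
    have : Group.FG (Abelianization H) :=
      Group.fg_of_surjective (f := Abelianization.of) QuotientGroup.mk_surjective
    refine isNoetherianGroup_of_action S N (hH.subgroup N) (MulAut.restrictInvariant S N hNinv)
      (ih (hH.subgroup N) inferInstance _ ?_ hNn)
      (fun s hs n hn ↦ MulAut.eq_of_restrictInvariant_eq_one hs hn) φ₂
      (isNoetherianGroup_of_isSolvable_mulAut_comm _ ?_) ?_
    · exact Group.isSolvable_of_surjective (MonoidHom.rangeRestrict_surjective _)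
    · exact Group.isSolvable_of_surjective (MonoidHom.rangeRestrict_surjective _)
    · intro s hs x
      have h := DFunLike.congr_fun hs (Abelianization.of x)
      exact QuotientGroup.eq.mp h.symm

/-! ### Ascending the subnormal chain. -/

/-- A soluble group is Noetherian if it has a Noetherian normal subgroup that contains its
centralizer. -/
theorem IsNoetherianGroup.of_normal_of_centralizer_le {G : Type*} [Group G]
    (hG : Group.IsSolvable G) (H : Subgroup G) [H.Normal] (hH : IsNoetherianGroup H)
    (hc : Subgroup.centralizer (H : Set G) ≤ H) : IsNoetherianGroup G := by
  refine IsNoetherianGroup.of_ker_of_range (MulAut.conjNormal (H := H)) ?_ ?_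
  · refine hH.of_le fun g hg ↦ hc fun h hh ↦ ?_
    have h1 := congrArg Subtype.val (DFunLike.congr_fun hg ⟨h, hh⟩)
    rw [MulAut.conjNormal_apply] at h1
    exact (mul_inv_eq_iff_eq_mul.mp h1).symm
  · exact isNoetherianGroup_of_isSolvable_mulAut hH inferInstance _
      (Group.isSolvable_of_surjective (MonoidHom.rangeRestrict_surjective _))

theorem Subgroup.IsSubnormal.isNoetherianGroup {G : Type*} [Group G] (hA : IsAGroup G)
    (hsol : Group.IsSolvable G) {H : Subgroup G} (h : H.IsSubnormal)
    (hc : ¬ IsMulCommutative H) (hH : IsNoetherianGroup H) : IsNoetherianGroup G := by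
  induction h with
  | top =>
    exact hH.of_injective (Subgroup.topEquiv (G := G)).symm.toMonoidHom
      (Subgroup.topEquiv (G := G)).symm.injective
  | step H K hle hK hN ih =>
    -- A group containing the non-abelian `H` is non-abelian, so both hypotheses pass from `H` to
    -- `K`.
    refine ih (fun hKc ↦ hc ⟨⟨fun a b ↦ Subtype.ext ?_⟩⟩) ?_
    · exact congrArg (Subtype.val : K → G)
        (hKc.is_comm.comm (⟨a, hle a.2⟩ : K) ⟨b, hle b.2⟩)
    · refine IsNoetherianGroup.of_normal_of_centralizer_le inferInstance (H.subgroupOf K) ?_ ?_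
      · exact hH.of_injective (Subgroup.subgroupOfEquivOfLe hle).toMonoidHom
          (Subgroup.subgroupOfEquivOfLe hle).injective
      · intro k hk
        refine hA H hc fun h hh ↦ ?_
        exact congrArg Subtype.val (hk ⟨h, hle hh⟩ hh)

theorem propositionp {G : Type*} [Group G] (hA : IsAGroup G) (hsol : Group.IsSolvable G)
    (hsub : ∃ H : Subgroup G,
      H.IsSubnormal ∧ ¬ IsMulCommutative H ∧ IsPolycyclicGroup H) :
    IsPolycyclicGroup G := by
  obtain ⟨H, hH, hc, hp⟩ := hsub
  exact (hH.isNoetherianGroup hA hsol hc hp.isNoetherianGroup).isPolycyclicGroup hsol
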